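/- There exist $d\in\mathbb{N}$ and real symmetric $d\times d$ matrices $A$ and $\Sigma$, with $A$ of full rank, $\Sigma$ positive semidefinite and rank-deficient, and with no common eigenvector, such that the following holds for every stepsize $\eta>0$. Let $f(x)=\tfrac12 x^\top A x$, let $x_0\in\mathbb{R}^d$ be any deterministic starting point, let $\xi_0,\xi_1,\dots$ be independent $\mathcal{N}(0,\Sigma)$ random vectors, and let $$x_{k+1}=x_k-\eta\,(\nabla f(x_k)+\xi_k),\qquad k\ge 0,$$ be the SGD iterates. Then there is no complex Ornstein–Uhlenbeck process $$dX_t=BX_t\,dt+D\,dW_t$$ with $B\in\mathbb{C}^{d\times d}$, $D\in\mathbb{C}^{d\times m}$ (for any $m$), $W$ an $m$-dimensional standard real Wiener process and $X_0$ independent of $W$, that matches the marginal distributions of the SGD iterates at all times $k\eta$, $k=0,1,2,\dots$. Here matching means that for every $k\geq 0$ the vector $z=X_{k\eta}$ is a complex Gaussian vector (that is, $(\operatorname{Re}z,\operatorname{Im}z)$ is a real Gaussian vector) with $$\mathbb{E}[\operatorname{Re}z]=\mathbb{E}[x_k],\qquad \mathbb{E}[\operatorname{Im}z]=0,\qquad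 \Gamma(z)=C(z)=\operatorname{Cov}(x_k,x_k),$$ where $\Gamma(z)=\mathbb{E}[(z-\mathbb{E}z)(z-\mathbb{E}z)^{H}]$ is the covariance and $C(z)=\mathbb{E}[(z-\mathbb{E}z)(z-\mathbb{E}z)^{\top}]$ the pseudo-covariance. -/

import Mathlib

open MeasureTheory ProbabilityTheory
open scoped NNReal Matrix ComplexConjugate

namespace SGDComplexOU

noncomputable section

/-! ### SGD on a quadratic with additive Gaussian noise -/

/-- The quadratic objective `f(x) = (1/2) xᵀ A x`. -/
def quadObjective {d : ℕ} (A : Matrix (Fin d) (Fin d) ℝ) (x : EuclideanSpace ℝ (Fin d)) : ℝ :=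
  (1 / 2) * (x.ofLp ⬝ᵥ (A *ᵥ x.ofLp))

/-- The stochastic gradient `∇f(x) + ξ` of the quadratic objective. -/
def stochasticGradient {d : ℕ} (A : Matrix (Fin d) (Fin d) ℝ)
    (x ξ : EuclideanSpace ℝ (Fin d)) : EuclideanSpace ℝ (Fin d) :=
  gradient (quadObjective A) x + ξ

/-- The SGD iterates `x_{k+1} = x_k - η (∇f(x_k) + ξ_k)` with constant stepsize `η`, started at
the deterministic point `x₀` and driven by the noise sequence `ξ`. -/
def sgdIterate {Ω : Type*} {d : ℕ} (A : Matrix (Fin d) (Fin d) ℝ) (η : ℝ)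
    (x₀ : EuclideanSpace ℝ (Fin d)) (ξ : ℕ → Ω → EuclideanSpace ℝ (Fin d)) :
    ℕ → Ω → EuclideanSpace ℝ (Fin d)
  | 0, _ => x₀
  | k + 1, ω => sgdIterate A η x₀ ξ k ω - η • stochasticGradient A (sgdIterate A η x₀ ξ k ω) (ξ k ω)

/-- `ξ` is a sequence of independent random vectors with common law `N(0, S)`. -/
structure IsGaussianNoise {Ω : Type*} [MeasurableSpace Ω] {d : ℕ}
    (S : Matrix (Fin d) (Fin d) ℝ) (ξ : ℕ → Ω → EuclideanSpace ℝ (Fin d)) (P : Measure Ω) :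
    Prop where
  hasLaw : ∀ k, HasLaw (ξ k) (multivariateGaussian 0 S) P
  indep : iIndepFun ξ P

/-! ### Complex Ornstein–Uhlenbeck processes -/

/-- `W` is an `m`-dimensional standard Wiener process: its coordinates are independent standard
real Brownian motions. -/
structure IsWienerProcess {Ω : Type*} [MeasurableSpace Ω] {m : ℕ}
    (W : ℝ≥0 → Ω → Fin m → ℝ) (P : Measure Ω) : Prop where
  isBrownian : ∀ j, IsBrownianReal (fun t ω => W t ω j) P
  indep : iIndepFun (fun j ω (t : ℝ≥0) => W t ω j) P

/-- `X` is a complex Ornstein–Uhlenbeck process, i.e. a solution of `dX_t = B X_t dt + D dW_t`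
driven by the real Wiener process `W`, with an initial value independent of `W`. As `D` is
constant, the stochastic integral of `D` over `[0, t]` is `D (W_t - W_0)`, so that the equation
in integral form is pathwise. -/
structure IsComplexOU {Ω : Type*} [MeasurableSpace Ω] {d m : ℕ}
    (B : Matrix (Fin d) (Fin d) ℂ) (D : Matrix (Fin d) (Fin m) ℂ)
    (W : ℝ≥0 → Ω → Fin m → ℝ) (X : ℝ≥0 → Ω → Fin d → ℂ) (P : Measure Ω) : Prop where
  wiener : IsWienerProcess W P
  aemeasurable_init : AEMeasurable (X 0) P
  indep_init : IndepFun (X 0) (fun ω (t : ℝ≥0) => W t ω) P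
  continuous_paths : ∀ᵐ ω ∂P, Continuous (fun t => X t ω)
  equation : ∀ᵐ ω ∂P, ∀ t : ℝ≥0,
    X t ω = X 0 ω + (∫ s in (0 : ℝ)..t, B *ᵥ X s.toNNReal ω)
      + D *ᵥ (fun j => ((W t ω j - W 0 ω j : ℝ) : ℂ))

/-! ### Matching of a complex and a real Gaussian vector -/

/-- `z = x + i y` is a complex Gaussian vector: `(x, y)` is a (real) Gaussian vector. -/
def IsComplexGaussian {Ω : Type*} [MeasurableSpace Ω] {d : ℕ} (z : Ω → Fin d → ℂ)
    (P : Measure Ω) : Prop :=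
  HasGaussianLaw
    (fun ω => ((fun i => (z ω i).re, fun i => (z ω i).im) : (Fin d → ℝ) × (Fin d → ℝ))) P

/-- The covariance matrix `Γ(z) = E[(z - E z)(z - E z)ᴴ]`. -/
def complexCov {Ω : Type*} [MeasurableSpace Ω] {d : ℕ} (z : Ω → Fin d → ℂ) (P : Measure Ω) :
    Matrix (Fin d) (Fin d) ℂ :=
  Matrix.of fun i j => ∫ ω, (z ω i - ∫ ω', z ω' i ∂P) * conj (z ω j - ∫ ω', z ω' j ∂P) ∂P

/-- The pseudo-covariance matrix `C(z) = E[(z - E z)(z - E z)ᵀ]`. -/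
def pseudoCov {Ω : Type*} [MeasurableSpace Ω] {d : ℕ} (z : Ω → Fin d → ℂ) (P : Measure Ω) :
    Matrix (Fin d) (Fin d) ℂ :=
  Matrix.of fun i j => ∫ ω, (z ω i - ∫ ω', z ω' i ∂P) * (z ω j - ∫ ω', z ω' j ∂P) ∂P

/-- The covariance matrix of a real random vector. -/
def realCov {Ω : Type*} [MeasurableSpace Ω] {d : ℕ} (x : Ω → EuclideanSpace ℝ (Fin d))
    (P : Measure Ω) : Matrix (Fin d) (Fin d) ℝ :=
  Matrix.of fun i j => cov[fun ω => x ω i, fun ω => x ω j; P]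

/-- The complex Gaussian vector `z` matches the real Gaussian vector `x` (which may live on
another probability space): `E Re z = E x`, `E Im z = 0` and `Γ(z) = C(z) = Cov(x, x)`. -/
structure Matches {Ω Ω' : Type*} [MeasurableSpace Ω] [MeasurableSpace Ω'] {d : ℕ}
    (z : Ω → Fin d → ℂ) (P : Measure Ω) (x : Ω' → EuclideanSpace ℝ (Fin d)) (Q : Measure Ω') :
    Prop where
  gaussian : IsComplexGaussian z P
  mean_re : ∀ i, ∫ ω, (z ω i).re ∂P = ∫ ω, x ω i ∂Q
  mean_im : ∀ i, ∫ ω, (z ω i).im ∂P = 0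
  cov_eq : complexCov z P = (realCov x Q).map Complex.ofReal
  pseudoCov_eq : pseudoCov z P = (realCov x Q).map Complex.ofReal

/-- The process `X` matches the iterates `x` at the times `kη`, `k = 0, 1, 2, …`, marginally. -/
def MatchesIterates {Ω Ω' : Type*} [MeasurableSpace Ω] [MeasurableSpace Ω'] {d : ℕ} (η : ℝ)
    (X : ℝ≥0 → Ω → Fin d → ℂ) (P : Measure Ω)
    (x : ℕ → Ω' → EuclideanSpace ℝ (Fin d)) (Q : Measure Ω') : Prop :=
  ∀ k : ℕ, Matches (X (Real.toNNReal (k * η))) P (x k) Q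

end

end SGDComplexOU

/-! Take `A = diag(1, 2)`, let `Σ` be the all-ones matrix, and test everything against `u = (1,
-1)`. The noise is degenerate along `u`, so `u · x_1` is deterministic. The unequal curvatures then
rotate the first noise vector out of its line, and `u · x_2` has variance `η ^ 4 > 0`. SGD therefore
gains a noisy direction between its first and second steps.

An Ornstein–Uhlenbeck process cannot do this. Matching at time 0 makes `X_0` constant, and then `u ·
X_T` is random only through the kernel `ψ t = u exp (t B) D` on `[0, T]`. If `u · X_T` is
deterministic for one `T > 0`, then `ψ` vanishes on `(0, T)`, hence everywhere by analyticity, and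
`u · X_S` is deterministic for every `S` (`IsComplexOU.ae_const_of_ae_const`). The times `T = η` and
`S = 2η` give the contradiction; `Matches.ae_const_iff` transfers degeneracy between the two
processes through the covariance.

No stochastic integral is needed. Since `D` is constant, integration by parts expresses `u · X_T`
pathwise through `W`. Correlating it with `W_t` and using the covariance `min s t` yields `∫ s in
0..t, ψ (T - s) = 0` for `t ≤ T`. -/

namespace SGDComplexOU

open Set Filter

/-! ### Deterministic calculus: row exponentials, variation of constants, the `min` kernel -/

section RowExp

open scoped Matrix.Norms.Operator

/-- The solution `q t = u exp (t B)` of the row equation `q' = q B`, `q 0 = u`. -/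
theorem exists_analytic_row_solution {d : ℕ} (B : Matrix (Fin d) (Fin d) ℂ) (u : Fin d → ℂ) :
    ∃ q : ℝ → Fin d → ℂ, q 0 = u ∧ (∀ t, HasDerivAt q (q t ᵥ* B) t) ∧ AnalyticOnNhd ℝ q univ := by
  let φ : Matrix (Fin d) (Fin d) ℂ →L[ℝ] (Fin d → ℂ) :=
    LinearMap.toContinuousLinearMap
      { toFun := fun M => u ᵥ* M
        map_add' := fun M N => Matrix.vecMul_add M N u
        map_smul' := fun c M => Matrix.vecMul_smul u c M }
  refine ⟨fun t => φ (NormedSpace.exp (t • B)), ?_, fun t => ?_, fun t _ => ?_⟩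
  · change u ᵥ* NormedSpace.exp ((0 : ℝ) • B) = u
    simp
  · have h := (φ.hasFDerivAt (x := NormedSpace.exp (t • B))).comp_hasDerivAt t
      (hasDerivAt_exp_smul_const (𝕂 := ℝ) B t)
    have h2 : φ (NormedSpace.exp (t • B) * B) = φ (NormedSpace.exp (t • B)) ᵥ* B :=
      (Matrix.vecMul_vecMul u _ B).symm
    exact h.congr_deriv h2
  · have h1 : AnalyticAt ℝ (fun t : ℝ => t • B) t := by fun_prop
    have h2 : AnalyticAt ℝ (NormedSpace.exp : Matrix (Fin d) (Fin d) ℂ → _) (t • B) :=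
      NormedSpace.exp_analytic _
    exact (φ.analyticAt _).comp (AnalyticAt.fun_comp h2 h1)

end RowExp

/-- Variation of constants, tested against a row vector. -/
theorem dotProduct_eq_of_integral_equation {d m : ℕ} {B : Matrix (Fin d) (Fin d) ℂ}
    {D : Matrix (Fin d) (Fin m) ℂ} {q : ℝ → Fin d → ℂ} (hq : ∀ t, HasDerivAt q (q t ᵥ* B) t)
    {x : ℝ≥0 → Fin d → ℂ} (hx : Continuous x) {w : ℝ≥0 → Fin m → ℂ}
    (heq : ∀ t : ℝ≥0, x t = x 0 + (∫ s in (0 : ℝ)..t, B *ᵥ x s.toNNReal) + D *ᵥ w t) (T : ℝ≥0) :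
    q 0 ⬝ᵥ x T = q T ⬝ᵥ x 0 + (q 0 ᵥ* D) ⬝ᵥ w T
      + ∫ s in (0 : ℝ)..T, ((q (T - s) ᵥ* B) ᵥ* D) ⬝ᵥ w s.toNNReal := by
  have hBx : Continuous fun s : ℝ => B *ᵥ x s.toNNReal := by fun_prop
  -- The path `x` need not be differentiable, but `y = x - D w` is, so the fundamental theorem of
  -- calculus applies to `q (T - s) ⬝ᵥ y s`.
  set y : ℝ → Fin d → ℂ := fun t => x 0 + ∫ s in (0 : ℝ)..t, B *ᵥ x s.toNNReal with hy
  have hy' : ∀ t, HasDerivAt y (B *ᵥ x t.toNNReal) t := fun t =>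
    (intervalIntegral.integral_hasDerivAt_right (hBx.intervalIntegrable _ _)
      hBx.aestronglyMeasurable.stronglyMeasurableAtFilter hBx.continuousAt).const_add _
  have hqc : Continuous q := continuous_iff_continuousAt.2 fun t => (hq t).continuousAt
  have hq' : ∀ s : ℝ, HasDerivAt (fun s => q (T - s)) (-(q (T - s) ᵥ* B)) s := fun s => by
    simpa using (hq (T - s)).comp_const_sub (T : ℝ) s
  have hder : ∀ s : ℝ, HasDerivAt (fun s => q (T - s) ⬝ᵥ y s)
      (-(q (T - s) ᵥ* B) ⬝ᵥ y s + q (T - s) ⬝ᵥ (B *ᵥ x s.toNNReal)) s := fun s => by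
    have := HasDerivAt.fun_sum (u := Finset.univ) fun i _ =>
      (hasDerivAt_pi.1 (hq' s) i).fun_mul (hasDerivAt_pi.1 (hy' s) i)
    simpa only [dotProduct, Finset.sum_add_distrib] using this
  have hyc : Continuous y := continuous_iff_continuousAt.2 fun t => (hy' t).continuousAt
  have hftc := intervalIntegral.integral_eq_sub_of_hasDerivAt (a := 0) (b := (T : ℝ))
    (fun s _ => hder s) (Continuous.intervalIntegrable (by fun_prop) _ _)
  have hcongr : ∫ s in (0 : ℝ)..T,
        (-(q (T - s) ᵥ* B) ⬝ᵥ y s + q (T - s) ⬝ᵥ (B *ᵥ x s.toNNReal))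
      = ∫ s in (0 : ℝ)..T, ((q (T - s) ᵥ* B) ᵥ* D) ⬝ᵥ w s.toNNReal := by
    refine intervalIntegral.integral_congr fun s hs => ?_
    rw [uIcc_of_le T.coe_nonneg] at hs
    have h := heq s.toNNReal
    rw [Real.coe_toNNReal s hs.1] at h
    have h2 : x s.toNNReal = y s + D *ᵥ w s.toNNReal := h
    rw [h2, Matrix.mulVec_add, dotProduct_add (q (T - s)), Matrix.dotProduct_mulVec _ B (y s),
      neg_dotProduct,
      neg_add_cancel_left, Matrix.dotProduct_mulVec, Matrix.dotProduct_mulVec]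
  rw [hcongr] at hftc
  have hT : x T = y T + D *ᵥ w T := heq T
  rw [hftc, hT, dotProduct_add, Matrix.dotProduct_mulVec]
  simp [hy]
  ring

/-- Integration by parts against `s ↦ min s t`. -/
theorem integral_deriv_mul_min {g g' : ℝ → ℂ} (hg : ∀ s, HasDerivAt g (g' s) s)
    (hg' : Continuous g') {t T : ℝ} (h0 : 0 ≤ t) (hT : t ≤ T) :
    ∫ s in (0 : ℝ)..T, g' s * (min s t : ℝ) = t * g T - ∫ s in (0 : ℝ)..t, g s := by
  have hgc : Continuous g := continuous_iff_continuousAt.2 fun t => (hg t).continuousAt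
  have hc : Continuous fun s : ℝ => g' s * (min s t : ℝ) := by fun_prop
  rw [← intervalIntegral.integral_add_adjacent_intervals (hc.intervalIntegrable 0 t)
    (hc.intervalIntegrable t T)]
  have h1 : ∫ s in (0 : ℝ)..t, g' s * (min s t : ℝ) = ∫ s in (0 : ℝ)..t, g' s * (s : ℂ) :=
    intervalIntegral.integral_congr fun s hs => by
      rw [uIcc_of_le h0] at hs
      simp [min_eq_left hs.2]
  have h2 : ∫ s in t..T, g' s * (min s t : ℝ) = ∫ s in t..T, g' s * (t : ℂ) :=
    intervalIntegral.integral_congr fun s hs => by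
      rw [uIcc_of_le hT] at hs
      simp [min_eq_right hs.1]
  have h3 := intervalIntegral.integral_mul_deriv_eq_deriv_mul (a := 0) (b := t)
    (u := fun s : ℝ => (s : ℂ)) (u' := fun _ => 1) (v := g) (v' := g')
    (fun s _ => Complex.ofRealCLM.hasDerivAt) (fun s _ => hg s)
    (continuous_const.intervalIntegrable _ _) (hg'.intervalIntegrable _ _)
  have h4 := intervalIntegral.integral_eq_sub_of_hasDerivAt (a := t) (b := T)
    (fun s _ => hg s) (hg'.intervalIntegrable _ _)
  rw [h1, h2, intervalIntegral.integral_mul_const, h4]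
  simp only [mul_comm (g' _)]
  rw [h3]
  simp
  ring

/-- A function whose kernel functional against `min` vanishes is zero. -/
theorem eq_zero_of_integral_deriv_mul_min {ψ ψ' : ℝ → ℂ} (hψ : ∀ s, HasDerivAt ψ (ψ' s) s)
    (hψ' : Continuous ψ') {T : ℝ}
    (h : ∀ t ∈ Icc 0 T, ψ 0 * t + ∫ s in (0 : ℝ)..T, ψ' (T - s) * (min s t : ℝ) = 0) :
    ∀ t ∈ Ioo 0 T, ψ t = 0 := by
  have hψc : Continuous ψ := continuous_iff_continuousAt.2 fun t => (hψ t).continuousAt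
  -- This antiderivative equals `-ψ 0` at `s = T`, so the boundary term of the integration by parts
  -- cancels `ψ 0 * t` in `h`.
  have hg : ∀ s : ℝ, HasDerivAt (fun s => -ψ (T - s)) (ψ' (T - s)) s := fun s => by
    simpa using ((hψ (T - s)).comp_const_sub T s).fun_neg
  have hzero : ∀ t ∈ Icc 0 T, ∫ s in (0 : ℝ)..t, ψ (T - s) = 0 := fun t ht => by
    have h1 := h t ht
    rw [integral_deriv_mul_min hg (by fun_prop) ht.1 ht.2] at h1
    simp only [sub_self, intervalIntegral.integral_neg] at h1
    linear_combination h1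
  have hc : Continuous fun s => ψ (T - s) := by fun_prop
  have key : ∀ t ∈ Ioo 0 T, ψ (T - t) = 0 := fun t ht => by
    have h1 : HasDerivAt (fun t => ∫ s in (0 : ℝ)..t, ψ (T - s)) (ψ (T - t)) t :=
      intervalIntegral.integral_hasDerivAt_right (hc.intervalIntegrable _ _)
        hc.aestronglyMeasurable.stronglyMeasurableAtFilter hc.continuousAt
    have h2 : (fun t => ∫ s in (0 : ℝ)..t, ψ (T - s)) =ᶠ[nhds t] fun _ => 0 := by
      filter_upwards [Ioo_mem_nhds ht.1 ht.2] with s hs using hzero s (Ioo_subset_Icc_self hs)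
    exact (h1.congr_of_eventuallyEq h2.symm).unique (hasDerivAt_const t 0)
  intro t ht
  simpa using key (T - t) ⟨by linarith [ht.2], by linarith [ht.1]⟩

/-! ### Measurability, Fubini and moments for Wiener paths -/

/-- A process with almost surely continuous paths is indistinguishable from a measurable process
all of whose paths are continuous. -/
theorem exists_measurable_continuous_modification {Ω : Type*} [MeasurableSpace Ω] {P : Measure Ω}
    {W : ℝ≥0 → Ω → ℝ} (hm : ∀ t, AEMeasurable (W t) P)
    (hc : ∀ᵐ ω ∂P, Continuous fun t => W t ω) :
    ∃ V : ℝ≥0 → Ω → ℝ, (∀ ω, Continuous fun t => V t ω) ∧ (∀ t, Measurable (V t)) ∧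
      ∀ᵐ ω ∂P, ∀ t, V t ω = W t ω := by
  classical
  let e : ℕ → ℝ≥0 := TopologicalSpace.denseSeq ℝ≥0
  have hgood : ∀ᵐ ω ∂P, (Continuous fun t => W t ω) ∧ ∀ n, W (e n) ω = (hm (e n)).mk _ ω :=
    hc.and (ae_all_iff.2 fun n => (hm (e n)).ae_eq_mk)
  -- The exceptional set need not be measurable; setting the process to zero on a measurable null
  -- superset keeps it measurable at the dense times.
  obtain ⟨N, hsub, hN, hN0⟩ := exists_measurable_superset_of_null (ae_iff.1 hgood)
  have hG : ∀ ω, ω ∉ N →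
      (Continuous fun t => W t ω) ∧ ∀ n, W (e n) ω = (hm (e n)).mk _ ω := fun ω hω => by
    by_contra hcon
    exact hω (hsub hcon)
  let V : ℝ≥0 → Ω → ℝ := fun t ω => if ω ∈ N then 0 else W t ω
  have hVc : ∀ ω, Continuous fun t => V t ω := fun ω => by
    by_cases hω : ω ∈ N
    · simpa [V, hω] using continuous_const
    · simpa [V, hω] using (hG ω hω).1
  have hVe : ∀ n, Measurable (V (e n)) := fun n => by
    have h : V (e n) = fun ω => if ω ∈ N then 0 else (hm (e n)).mk _ ω := by
      funext ω
      by_cases hω : ω ∈ N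
      · simp [V, hω]
      · simp [V, hω, (hG ω hω).2 n]
    rw [h]
    exact Measurable.ite hN measurable_const (hm (e n)).measurable_mk
  refine ⟨V, hVc, fun t => ?_, ?_⟩
  · obtain ⟨a, ha, hat⟩ := mem_closure_iff_seq_limit.1
      (TopologicalSpace.denseRange_denseSeq ℝ≥0 t)
    choose n hn using ha
    refine measurable_of_tendsto_metrizable (f := fun k => V (a k)) (fun k => ?_) ?_
    · rw [← hn k]
      exact hVe _
    · exact tendsto_pi_nhds.2 fun ω => ((hVc ω).tendsto t).comp hat
  · filter_upwards [compl_mem_ae_iff.2 hN0] with ω hω t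
    have : ω ∉ N := hω
    simp [V, this]

/-- Fubini for a weighted time integral of a square-integrable process against a
square-integrable variable. -/
theorem integral_timeIntegral_mul {Ω : Type*} [MeasurableSpace Ω] {P : Measure Ω}
    [IsProbabilityMeasure P] {V : ℝ≥0 → Ω → ℝ} (hVc : ∀ ω, Continuous fun t => V t ω)
    (hVm : ∀ t, Measurable (V t)) {C : ℝ → ℝ} (hC : Continuous C)
    (hV : ∀ t, MemLp (V t) 2 P) (hVC : ∀ t, ∫ ω, V t ω ^ 2 ∂P ≤ C t)
    {Y : Ω → ℝ} (hYm : Measurable Y) (hY : MemLp Y 2 P) {h : ℝ → ℂ} (hh : Continuous h)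
    {T : ℝ} (hT : 0 ≤ T) :
    Integrable (fun ω => (∫ s in (0 : ℝ)..T, h s * V s.toNNReal ω) * Y ω) P ∧
    ∫ ω, (∫ s in (0 : ℝ)..T, h s * V s.toNNReal ω) * Y ω ∂P
      = ∫ s in (0 : ℝ)..T, h s * ((∫ ω, V s.toNNReal ω * Y ω ∂P : ℝ) : ℂ) := by
  have hVu : Measurable (Function.uncurry fun (s : ℝ) ω => V s.toNNReal ω) := by
    have h1 : Measurable (Function.uncurry V) :=
      measurable_uncurry_of_continuous_of_measurable hVc hVm
    exact h1.comp ((measurable_real_toNNReal.comp measurable_fst).prodMk measurable_snd)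
  let F : ℝ × Ω → ℂ := fun p => h p.1 * V p.1.toNNReal p.2 * Y p.2
  have hF : Measurable F := by
    have h2 : Measurable fun p : ℝ × Ω => V p.1.toNNReal p.2 := hVu
    exact ((hh.measurable.comp measurable_fst).mul (Complex.measurable_ofReal.comp h2)).mul
      (Complex.measurable_ofReal.comp (hYm.comp measurable_snd))
  have hVY : ∀ t, Integrable (fun ω => V t ω * Y ω) P := fun t => (hV t).integrable_mul hY
  have hint : Integrable F ((volume.restrict (Ioc 0 T)).prod P) := by
    rw [integrable_prod_iff hF.aestronglyMeasurable]
    constructor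
    · refine Eventually.of_forall fun s => ?_
      have := ((hVY s.toNNReal).ofReal (𝕜 := ℂ)).const_mul (h s)
      simpa [F, mul_assoc] using this
    -- Domination comes from `|V Y| ≤ V ^ 2 + Y ^ 2`, whose expectation is bounded by a continuous
    -- function of time.
    · have hb : Integrable (fun s => ‖h s‖ * (C s.toNNReal + ∫ ω, Y ω ^ 2 ∂P))
          (volume.restrict (Ioc 0 T)) := by
        have : Continuous fun s : ℝ => ‖h s‖ * (C s.toNNReal + ∫ ω, Y ω ^ 2 ∂P) := by fun_prop
        exact (this.intervalIntegrable 0 T).1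
      refine hb.mono' (hF.aestronglyMeasurable.norm.integral_prod_right') ?_
      refine Eventually.of_forall fun s => ?_
      rw [Real.norm_of_nonneg (integral_nonneg fun _ => norm_nonneg _)]
      have hle : ∫ ω, ‖F (s, ω)‖ ∂P
          ≤ ∫ ω, ‖h s‖ * (V s.toNNReal ω ^ 2 + Y ω ^ 2) ∂P := by
        refine integral_mono_of_nonneg (Eventually.of_forall fun _ => norm_nonneg _)
          (((hV _).integrable_sq.add hY.integrable_sq).const_mul _)
          (Eventually.of_forall fun ω => ?_)
        simp only [F, norm_mul, Complex.norm_real, mul_assoc]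
        gcongr
        rw [← norm_mul, Real.norm_eq_abs, abs_le]
        constructor <;> nlinarith [sq_nonneg (V s.toNNReal ω + Y ω), sq_nonneg (V s.toNNReal ω),
          sq_nonneg (V s.toNNReal ω - Y ω), sq_nonneg (Y ω)]
      refine hle.trans ?_
      rw [integral_const_mul, integral_add (hV _).integrable_sq hY.integrable_sq]
      gcongr
      exact hVC _
  have hpull : ∀ ω, (∫ s in (0 : ℝ)..T, h s * V s.toNNReal ω) * Y ω
      = ∫ s in Ioc 0 T, F (s, ω) := fun ω => by
    rw [intervalIntegral.integral_of_le hT, ← integral_mul_const]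
  simp only [hpull]
  refine ⟨hint.integral_prod_right, ?_⟩
  rw [intervalIntegral.integral_of_le hT, ← integral_integral_swap (f := fun s ω => F (s, ω)) hint]
  refine integral_congr_ae (Eventually.of_forall fun s => ?_)
  simp only [F, mul_assoc]
  rw [integral_const_mul]
  congr 1
  rw [← integral_complex_ofReal]
  simp

/-- A Wiener process is indistinguishable from a measurable one with continuous paths; the first
two moments are recorded. -/
theorem IsWienerProcess.exists_modification {Ω : Type*} [MeasurableSpace Ω] {P : Measure Ω}
    [IsProbabilityMeasure P] {m : ℕ} {W : ℝ≥0 → Ω → Fin m → ℝ} (hW : IsWienerProcess W P) :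
    ∃ V : Fin m → ℝ≥0 → Ω → ℝ, (∀ j ω, Continuous fun t => V j t ω) ∧
      (∀ j t, Measurable (V j t)) ∧ (∀ j t, MemLp (V j t) 2 P) ∧ (∀ j t, ∫ ω, V j t ω ∂P = 0) ∧
      (∀ j k s t, ∫ ω, V j s ω * V k t ω ∂P = if j = k then ((min s t : ℝ≥0) : ℝ) else 0) ∧
      ∀ᵐ ω ∂P, ∀ t j, V j t ω = W t ω j - W 0 ω j := by
  have hB := fun j => (hW.isBrownian j).toIsPreBrownianReal
  choose V hVc hVm hVW using fun j => exists_measurable_continuous_modification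
    (fun t => (hB j).aemeasurable t) (hW.isBrownian j).cont
  have hVt : ∀ j t, V j t =ᵐ[P] fun ω => W t ω j := fun j t => (hVW j).mono fun ω h => h t
  have hL : ∀ j t, MemLp (fun ω => W t ω j) 2 P := fun j t =>
    ((hB j).hasLaw_eval t).hasGaussianLaw.memLp_two
  have hmean : ∀ j t, ∫ ω, W t ω j ∂P = 0 := fun j t => (hB j).integral_eval t
  refine ⟨V, hVc, hVm, fun j t => (hL j t).ae_eq (hVt j t).symm, fun j t => ?_,
    fun j k s t => ?_, ?_⟩
  · rw [integral_congr_ae (hVt j t), hmean]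
  · have h1 : ∫ ω, V j s ω * V k t ω ∂P = ∫ ω, W s ω j * W t ω k ∂P :=
      integral_congr_ae ((hVt j s).mul (hVt k t))
    have h2 := covariance_eq_sub (hL j s) (hL k t)
    rw [hmean, hmean, mul_zero, sub_zero] at h2
    change _ = ∫ ω, W s ω j * W t ω k ∂P at h2
    rw [h1, ← h2]
    split_ifs with hjk
    · subst hjk
      rw [(hB j).covariance_fun_eval]
    · have hind := (hW.indep.indepFun hjk).comp (measurable_pi_apply s) (measurable_pi_apply t)
      exact hind.covariance_eq_zero (hL j s) (hL k t)
  · have h0 : ∀ᵐ ω ∂P, ∀ j, W 0 ω j = 0 := ae_all_iff.2 fun j => (hB j).eval_zero_ae_eq_zero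
    filter_upwards [ae_all_iff.2 hVW, h0] with ω h h0 t j
    rw [h j t, h0 j, sub_zero]

/-! ### Degenerate directions of an Ornstein–Uhlenbeck process persist -/

/-- If a linear functional of a complex Ornstein–Uhlenbeck process started at a deterministic
point is almost surely constant at some positive time, then it is so at every time. -/
theorem IsComplexOU.ae_const_of_ae_const {Ω : Type*} [MeasurableSpace Ω] {P : Measure Ω}
    [IsProbabilityMeasure P] {d m : ℕ} {B : Matrix (Fin d) (Fin d) ℂ}
    {D : Matrix (Fin d) (Fin m) ℂ} {W : ℝ≥0 → Ω → Fin m → ℝ} {X : ℝ≥0 → Ω → Fin d → ℂ}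
    (hX : IsComplexOU B D W X P) {x₀ : Fin d → ℂ} (h0 : ∀ᵐ ω ∂P, X 0 ω = x₀) {u : Fin d → ℂ}
    {T : ℝ≥0} (hT : 0 < T) {c : ℂ} (hc : ∀ᵐ ω ∂P, u ⬝ᵥ X T ω = c) (S : ℝ≥0) :
    ∃ c', ∀ᵐ ω ∂P, u ⬝ᵥ X S ω = c' := by
  obtain ⟨V, hVc, hVm, hVL, hV0, hVV, hVW⟩ := hX.wiener.exists_modification
  obtain ⟨q, hq0, hq, hqa⟩ := exists_analytic_row_solution B u
  have hqc : Continuous q := continuous_iff_continuousAt.2 fun t => (hq t).continuousAt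
  let ψ : ℝ → Fin m → ℂ := fun t => q t ᵥ* D
  let ψ' : ℝ → Fin m → ℂ := fun t => (q t ᵥ* B) ᵥ* D
  have hψ' : Continuous ψ' := by fun_prop
  have hψ : ∀ j t, HasDerivAt (fun t => ψ t j) (ψ' t j) t := fun j t => by
    have := HasDerivAt.fun_sum (u := Finset.univ) fun i _ =>
      (hasDerivAt_pi.1 (hq t) i).mul_const (D i j)
    exact this
  have hrep : ∀ᵐ ω ∂P, ∀ t : ℝ≥0, u ⬝ᵥ X t ω = q t ⬝ᵥ x₀
      + ∑ j, (ψ 0 j * V j t ω + ∫ s in (0 : ℝ)..t, ψ' (t - s) j * V j s.toNNReal ω) := by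
    filter_upwards [hVW, h0, hX.continuous_paths, hX.equation] with ω hω h0ω hcω heq t
    have h1 := dotProduct_eq_of_integral_equation (T := t) hq hcω heq
    rw [hq0, h0ω] at h1
    have h2 : ∀ s j, ((W s ω j - W 0 ω j : ℝ) : ℂ) = V j s ω := fun s j => by rw [hω]
    simp only [h2] at h1
    have h3 : ∫ s in (0 : ℝ)..t, ((q (t - s) ᵥ* B) ᵥ* D) ⬝ᵥ (fun j => (V j s.toNNReal ω : ℂ))
        = ∑ j, ∫ s in (0 : ℝ)..t, ψ' (t - s) j * V j s.toNNReal ω := by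
      rw [← intervalIntegral.integral_finsetSum]
      · rfl
      · intro j _
        have := hVc j ω
        exact Continuous.intervalIntegrable (by fun_prop) _ _
    rw [h1, h3, Finset.sum_add_distrib, ← add_assoc]
    simp only [ψ, hq0]
    rfl
  -- Multiply the representation at time `T` by `V k t` and take expectations: the constant part
  -- dies since `V k t` is centred, and only `j = k` survives by independence of the coordinates.
  have hkey : ∀ k, ∀ t ∈ Icc (0 : ℝ) T,
      ψ 0 k * t + ∫ s in (0 : ℝ)..T, ψ' (T - s) k * (min s t : ℝ) = 0 := by
    intro k t ht
    lift t to ℝ≥0 using ht.1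
    have htT : t ≤ T := ht.2
    have hfub := fun j => integral_timeIntegral_mul (hVc j) (hVm j) continuous_id (hVL j)
      (fun s => (by simp [pow_two, hVV j j s s] : ∫ ω, V j s ω ^ 2 ∂P ≤ id (s : ℝ))) (hVm k t)
      (hVL k t) (h := fun s => ψ' (T - s) j) (by fun_prop) T.coe_nonneg
    have hint1 : ∀ j, Integrable (fun ω => ψ 0 j * ((V j T ω * V k t ω : ℝ) : ℂ)) P := fun j =>
      ((((hVL j T).integrable_mul (hVL k t)) : Integrable (fun ω => V j T ω * V k t ω) P).ofReal
        (𝕜 := ℂ)).const_mul _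
    have hE : ∫ ω, ∑ j, (ψ 0 j * ((V j T ω * V k t ω : ℝ) : ℂ)
          + (∫ s in (0 : ℝ)..T, ψ' (T - s) j * V j s.toNNReal ω) * V k t ω) ∂P
        = ∫ ω, (c - q T ⬝ᵥ x₀) * V k t ω ∂P := by
      refine integral_congr_ae ?_
      filter_upwards [hrep, hc] with ω h1 h2
      rw [← h2, h1 T, add_sub_cancel_left, Finset.sum_mul]
      refine Finset.sum_congr rfl fun j _ => ?_
      push_cast
      ring
    rw [integral_const_mul, integral_complex_ofReal, hV0, Complex.ofReal_zero, mul_zero,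
      integral_finsetSum _ fun j _ => by exact (hint1 j).add (hfub j).1] at hE
    rw [← hE, Finset.sum_eq_single k]
    · rw [integral_add (hint1 k) (hfub k).1, (hfub k).2, integral_const_mul,
        integral_complex_ofReal, hVV]
      simp only [hVV, if_true, min_eq_right htT]
      congr 1
      refine intervalIntegral.integral_congr fun s hs => ?_
      rw [uIcc_of_le T.coe_nonneg] at hs
      simp [Real.coe_toNNReal s hs.1]
    · intro j _ hjk
      rw [integral_add (hint1 j) (hfub j).1, (hfub j).2, integral_const_mul,
        integral_complex_ofReal, hVV]
      simp [hVV, hjk]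
    · simp
  have hzero : ∀ k t, ψ t k = 0 := by
    intro k
    have hloc := eq_zero_of_integral_deriv_mul_min (hψ k) (by fun_prop) (hkey k)
    have han : AnalyticOnNhd ℝ (fun t => ψ t k) univ := fun t ht => by
      have hqi : ∀ i, AnalyticAt ℝ (fun t => q t i) t := fun i =>
        ((ContinuousLinearMap.proj (R := ℝ) (φ := fun _ : Fin d => ℂ) i).analyticAt _).fun_comp
          (hqa t ht)
      have := Finset.analyticAt_fun_sum Finset.univ fun i _ =>
        (hqi i).fun_mul (analyticAt_const (v := D i k))
      exact this
    have hT' : (0 : ℝ) < T := hT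
    -- The identity theorem is anchored at the interior point `T / 2`, since vanishing is known only
    -- on the open interval.
    have hev : (fun t => ψ t k) =ᶠ[nhds ((T : ℝ) / 2)] 0 := by
      filter_upwards [Ioo_mem_nhds (half_pos hT') (half_lt_self hT')] with s hs using hloc s hs
    have := han.eqOn_zero_of_preconnected_of_eventuallyEq_zero isPreconnected_univ
      (mem_univ _) hev
    exact fun t => this (mem_univ t)
  have hzero' : ∀ k t, ψ' t k = 0 := fun k t =>
    (hψ k t).unique (by simpa only [hzero k] using hasDerivAt_const t (0 : ℂ))
  refine ⟨q S ⬝ᵥ x₀, hrep.mono fun ω h => ?_⟩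
  rw [h S]
  simp [hzero, hzero']

/-! ### Covariance matrices and degenerate directions -/

/-- The components of a complex Gaussian vector are square integrable. -/
theorem IsComplexGaussian.memLp_two {Ω : Type*} [MeasurableSpace Ω] {P : Measure Ω} {d : ℕ}
    {z : Ω → Fin d → ℂ} (hz : IsComplexGaussian z P) (i : Fin d) :
    MemLp (fun ω => z ω i) 2 P := by
  have h : MemLp _ 2 P := HasGaussianLaw.memLp_two hz
  have hre : MemLp (fun ω => (z ω i).re) 2 P :=
    ((ContinuousLinearMap.proj (R := ℝ) (φ := fun _ : Fin d => ℝ) i).comp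
      (ContinuousLinearMap.fst ℝ (Fin d → ℝ) (Fin d → ℝ))).comp_memLp' h
  have him : MemLp (fun ω => (z ω i).im) 2 P :=
    ((ContinuousLinearMap.proj (R := ℝ) (φ := fun _ : Fin d => ℝ) i).comp
      (ContinuousLinearMap.snd ℝ (Fin d → ℝ) (Fin d → ℝ))).comp_memLp' h
  have := (hre.ofReal (K := ℂ)).add ((him.ofReal (K := ℂ)).mul_const Complex.I)
  refine this.ae_eq (Eventually.of_forall fun ω => ?_)
  exact Complex.re_add_im (z ω i)

/-- The quadratic form of the covariance matrix of a complex vector. -/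
theorem sum_complexCov {Ω : Type*} [MeasurableSpace Ω] {P : Measure Ω} [IsProbabilityMeasure P]
    {d : ℕ} {z : Ω → Fin d → ℂ} (hz : ∀ i, MemLp (fun ω => z ω i) 2 P) (u : Fin d → ℝ) :
    ∑ i, ∑ j, ((u i * u j : ℝ) : ℂ) * complexCov z P i j
      = ((∫ ω, ‖∑ i, (u i : ℂ) * (z ω i - ∫ ω', z ω' i ∂P)‖ ^ 2 ∂P : ℝ) : ℂ) := by
  have hc : ∀ i, MemLp (fun ω => z ω i - ∫ ω', z ω' i ∂P) 2 P := fun i =>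
    (hz i).sub (memLp_const _)
  have hint : ∀ i j, Integrable (fun ω => ((u i * u j : ℝ) : ℂ) *
      ((z ω i - ∫ ω', z ω' i ∂P) * conj (z ω j - ∫ ω', z ω' j ∂P))) P := fun i j =>
    ((hc i).integrable_mul (hc j).star).const_mul _
  have hpt : ∀ ω, ((‖∑ i, (u i : ℂ) * (z ω i - ∫ ω', z ω' i ∂P)‖ ^ 2 : ℝ) : ℂ)
      = ∑ i, ∑ j, ((u i * u j : ℝ) : ℂ) *
        ((z ω i - ∫ ω', z ω' i ∂P) * conj (z ω j - ∫ ω', z ω' j ∂P)) := fun ω => by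
    -- Because `u` is real, conjugation leaves its coefficients alone in `‖w‖ ^ 2 = w * conj w`.
    rw [Complex.ofReal_pow, ← Complex.mul_conj', map_sum, Finset.sum_mul_sum]
    refine Finset.sum_congr rfl fun i _ => Finset.sum_congr rfl fun j _ => ?_
    rw [map_mul, Complex.conj_ofReal]
    push_cast
    ring
  rw [← integral_complex_ofReal, integral_congr_ae (Eventually.of_forall hpt),
    integral_finsetSum _ fun i _ => integrable_finsetSum _ fun j _ => hint i j]
  refine Finset.sum_congr rfl fun i _ => ?_
  rw [integral_finsetSum _ fun j _ => hint i j]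
  refine Finset.sum_congr rfl fun j _ => ?_
  rw [integral_const_mul]
  rfl

/-- The quadratic form of the covariance matrix of a real vector. -/
theorem sum_realCov {Ω : Type*} [MeasurableSpace Ω] {Q : Measure Ω}
    [IsProbabilityMeasure Q]
    {d : ℕ} {x : Ω → EuclideanSpace ℝ (Fin d)} (hx : ∀ i, MemLp (fun ω => x ω i) 2 Q)
    (u : Fin d → ℝ) :
    ∑ i, ∑ j, u i * u j * realCov x Q i j = Var[fun ω => ∑ i, u i * x ω i; Q] := by
  have hux : ∀ i, MemLp (fun ω => u i * x ω i) 2 Q := fun i => (hx i).const_mul _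
  rw [← covariance_self (memLp_finsetSum _ fun i _ => hux i).aemeasurable,
    covariance_fun_sum_fun_sum hux hux]
  refine Finset.sum_congr rfl fun i _ => Finset.sum_congr rfl fun j _ => ?_
  rw [covariance_const_mul_left, covariance_const_mul_right, realCov, Matrix.of_apply, mul_assoc]

/-- Under matching, a real linear functional is degenerate for one vector iff it is for the
other. -/
theorem Matches.ae_const_iff {Ω Ω' : Type*} [MeasurableSpace Ω] [MeasurableSpace Ω']
    {P : Measure Ω} {Q : Measure Ω'} [IsProbabilityMeasure P] [IsProbabilityMeasure Q] {d : ℕ}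
    {z : Ω → Fin d → ℂ} {x : Ω' → EuclideanSpace ℝ (Fin d)} (h : Matches z P x Q)
    (hx : ∀ i, MemLp (fun ω => x ω i) 2 Q) (u : Fin d → ℝ) :
    (∃ c, ∀ᵐ ω ∂P, (fun i => (u i : ℂ)) ⬝ᵥ z ω = c) ↔
      Var[fun ω => ∑ i, u i * x ω i; Q] = 0 := by
  have hz := h.gaussian.memLp_two
  have hvar : Var[fun ω => ∑ i, u i * x ω i; Q]
      = ∫ ω, ‖∑ i, (u i : ℂ) * (z ω i - ∫ ω', z ω' i ∂P)‖ ^ 2 ∂P := by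
    rw [← Complex.ofReal_inj, ← sum_complexCov hz, ← sum_realCov hx, h.cov_eq]
    simp
  have hcent : ∀ ω, ∑ i, (u i : ℂ) * (z ω i - ∫ ω', z ω' i ∂P)
      = (fun i => (u i : ℂ)) ⬝ᵥ z ω - ∑ i, (u i : ℂ) * ∫ ω', z ω' i ∂P := fun ω => by
    simp [dotProduct, mul_sub, Finset.sum_sub_distrib]
  have hmean : ∫ ω, (fun i => (u i : ℂ)) ⬝ᵥ z ω ∂P = ∑ i, (u i : ℂ) * ∫ ω', z ω' i ∂P := by
    simp only [dotProduct]
    rw [integral_finsetSum _ fun i _ => ((hz i).integrable one_le_two).const_mul _]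
    simp [integral_const_mul]
  have hL : MemLp (fun ω => ∑ i, (u i : ℂ) * (z ω i - ∫ ω', z ω' i ∂P)) 2 P :=
    memLp_finsetSum _ fun i _ => ((hz i).sub (memLp_const _)).const_mul _
  rw [hvar]
  constructor
  · rintro ⟨c, hc⟩
    rw [integral_congr_ae hc] at hmean
    refine integral_eq_zero_of_ae ?_
    filter_upwards [hc] with ω hω
    rw [hcent, ← hmean, hω]
    simp
  · intro h0
    rw [integral_eq_zero_iff_of_nonneg (fun _ => by positivity)
      (hL.integrable_norm_pow two_ne_zero)] at h0
    refine ⟨∑ i, (u i : ℂ) * ∫ ω', z ω' i ∂P, ?_⟩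
    filter_upwards [h0] with ω hω
    have h1 : ∑ i, (u i : ℂ) * (z ω i - ∫ ω', z ω' i ∂P) = 0 := by simpa using hω
    exact sub_eq_zero.1 (hcent ω ▸ h1)

/-! ### The SGD recursion and its second moments -/

/-- The gradient of the quadratic objective of a symmetric matrix. -/
theorem gradient_quadObjective {d : ℕ} {A : Matrix (Fin d) (Fin d) ℝ} (hA : A.IsSymm)
    (x : EuclideanSpace ℝ (Fin d)) :
    gradient (quadObjective A) x = WithLp.toLp 2 (A *ᵥ x.ofLp) := by
  refine HasGradientAt.gradient ?_
  rw [hasGradientAt_iff_hasFDerivAt]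
  let L : EuclideanSpace ℝ (Fin d) →L[ℝ] EuclideanSpace ℝ (Fin d) :=
    LinearMap.toContinuousLinearMap (Matrix.toEuclideanLin A)
  have hf : quadObjective A = fun y => (1 / 2) * inner ℝ y (L y) := by
    funext y
    simp [quadObjective, L, PiLp.inner_apply, dotProduct, Matrix.toLpLin_apply, mul_comm]
  rw [hf]
  refine (((hasFDerivAt_id x).inner ℝ (L.hasFDerivAt (x := x))).const_mul (1 / 2)).congr_fderiv ?_
  ext y
  -- Symmetry merges the two terms of the product rule, which absorbs the factor `1 / 2`.
  have hsymm : inner ℝ x (L y) = inner ℝ (L x) y := by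
    have h1 : inner ℝ x (L y) = (A *ᵥ y.ofLp) ⬝ᵥ x.ofLp := by
      simp [L, PiLp.inner_apply, dotProduct, Matrix.toLpLin_apply]
    have h2 : inner ℝ (L x) y = y.ofLp ⬝ᵥ (A *ᵥ x.ofLp) := by
      simp [L, PiLp.inner_apply, dotProduct, Matrix.toLpLin_apply]
    rw [h1, h2, Matrix.dotProduct_mulVec, ← Matrix.mulVec_transpose, hA.eq]
  have hLx : WithLp.toLp 2 (A *ᵥ x.ofLp) = L x := rfl
  simp [hsymm, hLx, real_inner_comm (L x) y]
  ring

theorem sgdIterate_zero {Ω : Type*} {d : ℕ} (A : Matrix (Fin d) (Fin d) ℝ) (η : ℝ)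
    (x₀ : EuclideanSpace ℝ (Fin d)) (ξ : ℕ → Ω → EuclideanSpace ℝ (Fin d)) (ω : Ω) :
    sgdIterate A η x₀ ξ 0 ω = x₀ := rfl

/-- The coordinates of the iterates obey the linear recursion. -/
theorem sgdIterate_succ_apply {Ω : Type*} {d : ℕ} {A : Matrix (Fin d) (Fin d) ℝ} (hA : A.IsSymm)
    (η : ℝ) (x₀ : EuclideanSpace ℝ (Fin d)) (ξ : ℕ → Ω → EuclideanSpace ℝ (Fin d)) (k : ℕ)
    (ω : Ω) (i : Fin d) :
    sgdIterate A η x₀ ξ (k + 1) ω i = sgdIterate A η x₀ ξ k ω i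
      - η * ((∑ j, A i j * sgdIterate A η x₀ ξ k ω j) + ξ k ω i) := by
  simp [sgdIterate, stochasticGradient, gradient_quadObjective hA, Matrix.mulVec, dotProduct,
    mul_add]

theorem IsGaussianNoise.memLp_two {Ω : Type*} [MeasurableSpace Ω] {Q : Measure Ω} {d : ℕ}
    {S : Matrix (Fin d) (Fin d) ℝ} {ξ : ℕ → Ω → EuclideanSpace ℝ (Fin d)}
    (h : IsGaussianNoise S ξ Q) (k : ℕ) (i : Fin d) : MemLp (fun ω => ξ k ω i) 2 Q :=
  (EuclideanSpace.proj (𝕜 := ℝ) i).comp_memLp' (h.hasLaw k).hasGaussianLaw.memLp_two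

theorem IsGaussianNoise.covariance_eval {Ω : Type*} [MeasurableSpace Ω] {Q : Measure Ω} {d : ℕ}
    {S : Matrix (Fin d) (Fin d) ℝ} (hS : S.PosSemidef) {ξ : ℕ → Ω → EuclideanSpace ℝ (Fin d)}
    (h : IsGaussianNoise S ξ Q) (k : ℕ) (i j : Fin d) :
    cov[fun ω => ξ k ω i, fun ω => ξ k ω j; Q] = S i j := by
  rw [← covariance_eval_multivariateGaussian (μ := 0) hS i j]
  exact (h.hasLaw k).covariance_fun_comp (f := fun x => x i) (g := fun x => x j)
    (Measurable.aemeasurable (by fun_prop)) (Measurable.aemeasurable (by fun_prop))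

theorem memLp_two_sgdIterate {Ω : Type*} [MeasurableSpace Ω] {Q : Measure Ω}
    [IsProbabilityMeasure Q] {d : ℕ} {A S : Matrix (Fin d) (Fin d) ℝ} (hA : A.IsSymm) (η : ℝ)
    (x₀ : EuclideanSpace ℝ (Fin d)) {ξ : ℕ → Ω → EuclideanSpace ℝ (Fin d)}
    (h : IsGaussianNoise S ξ Q) (k : ℕ) (i : Fin d) :
    MemLp (fun ω => sgdIterate A η x₀ ξ k ω i) 2 Q := by
  induction k generalizing i with
  | zero => exact memLp_const (x₀ i)
  | succ k ih =>
    simp only [sgdIterate_succ_apply hA]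
    exact (ih i).sub (((memLp_finsetSum _ fun j _ => (ih j).const_mul _).add
      (h.memLp_two k i)).const_mul _)

/-! ### The two-dimensional example -/

/-- The curvature matrix `diag(1, 2)`. -/
def curvature : Matrix (Fin 2) (Fin 2) ℝ := !![1, 0; 0, 2]

/-- The rank-one noise covariance with all entries equal to one. -/
def noiseCov : Matrix (Fin 2) (Fin 2) ℝ := !![1, 1; 1, 1]

theorem curvature_isSymm : curvature.IsSymm := by
  ext i j
  fin_cases i <;> fin_cases j <;> rfl

theorem rank_curvature : curvature.rank = 2 := by
  have h : IsUnit curvature := by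
    rw [Matrix.isUnit_iff_isUnit_det]
    simp [curvature, Matrix.det_fin_two]
  simpa using Matrix.rank_of_isUnit _ h

theorem noiseCov_eq_vecMulVec : noiseCov = Matrix.vecMulVec 1 (star 1) := by
  ext i j
  fin_cases i <;> fin_cases j <;> simp [noiseCov, Matrix.vecMulVec_apply]

theorem noiseCov_posSemidef : noiseCov.PosSemidef :=
  noiseCov_eq_vecMulVec ▸ Matrix.posSemidef_vecMulVec_self_star 1

theorem rank_noiseCov_lt : noiseCov.rank < 2 :=
  (noiseCov_eq_vecMulVec ▸ Matrix.rank_vecMulVec_le _ _ : noiseCov.rank ≤ 1).trans_lt one_lt_two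

/-- Eigenvectors of `diag(1, 2)` lie on the coordinate axes, while the all-ones matrix sends an axis
vector to a multiple of `(1, 1)`. -/
theorem no_common_eigenvector (w : Fin 2 → ℝ) (a b : ℝ) (hw : w ≠ 0) :
    ¬ (curvature *ᵥ w = a • w ∧ noiseCov *ᵥ w = b • w) := by
  rintro ⟨hA, hS⟩
  have a0 := congrFun hA 0
  have a1 := congrFun hA 1
  have s0 := congrFun hS 0
  have s1 := congrFun hS 1
  simp [curvature, noiseCov, Matrix.mulVec, dotProduct, Fin.sum_univ_two] at a0 a1 s0 s1
  apply hw
  have key : w 0 = 0 ∧ w 1 = 0 := by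
    by_cases h0 : w 0 = 0
    · rw [h0] at s0
      exact ⟨h0, by linarith⟩
    · have ha : a = 1 := mul_right_cancel₀ h0 (by linarith)
      have h1 : w 1 = 0 := by
        rcases a1 with h | h
        · rw [ha] at h; norm_num at h
        · exact h
      rw [h1] at s1
      exact ⟨by linarith, h1⟩
  ext i
  fin_cases i
  exacts [key.1, key.2]

/-- The two coordinates of the noise differ by a constant. -/
theorem noise_sub_ae_const {Ω : Type*} [MeasurableSpace Ω] {Q : Measure Ω}
    [IsProbabilityMeasure Q]
    {ξ : ℕ → Ω → EuclideanSpace ℝ (Fin 2)} (hξ : IsGaussianNoise noiseCov ξ Q) (k : ℕ) :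
    ∃ e, ∀ᵐ ω ∂Q, ξ k ω 0 - ξ k ω 1 = e := by
  have h0 := hξ.memLp_two k 0
  have h1 := hξ.memLp_two k 1
  have hc := hξ.covariance_eval noiseCov_posSemidef k
  refine ⟨_, ae_eq_integral_of_variance_eq_zero (h0.sub h1) ?_⟩
  rw [variance_fun_sub h0 h1, ← covariance_self h0.aemeasurable, ← covariance_self h1.aemeasurable,
    hc, hc, hc]
  norm_num [noiseCov]

/-- From a deterministic start the noise enters only as `-η` times the difference of its
coordinates, which is almost surely constant. -/
theorem variance_coord_sub_sgdIterate_one {Ω : Type*} [MeasurableSpace Ω] {Q : Measure Ω}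
    [IsProbabilityMeasure Q]
    {ξ : ℕ → Ω → EuclideanSpace ℝ (Fin 2)} (hξ : IsGaussianNoise noiseCov ξ Q)
    (η : ℝ) (x₀ : EuclideanSpace ℝ (Fin 2)) :
    Var[fun ω => ∑ i, ![1, -1] i * sgdIterate curvature η x₀ ξ 1 ω i; Q] = 0 := by
  obtain ⟨e, he⟩ := noise_sub_ae_const hξ 0
  rw [variance_congr (Y := fun _ => x₀ 0 - x₀ 1 - η * (x₀ 0 - 2 * x₀ 1 + e))]
  · rw [← covariance_self aemeasurable_const, covariance_const_left]
  · filter_upwards [he] with ω h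
    simp only [Fin.sum_univ_two, sgdIterate_succ_apply curvature_isSymm, sgdIterate_zero]
    simp [curvature]
    linear_combination -η * h

/-- The second step scales the coordinates of the first noise by `1 - η` and `1 - 2 * η`. Their
mismatch `η`, times the stepsize, leaves a coefficient `-η ^ 2` on a variable of unit variance,
whatever `η` is; the second noise adds only a constant. -/
theorem variance_coord_sub_sgdIterate_two {Ω : Type*} [MeasurableSpace Ω] {Q : Measure Ω}
    [IsProbabilityMeasure Q]
    {ξ : ℕ → Ω → EuclideanSpace ℝ (Fin 2)} (hξ : IsGaussianNoise noiseCov ξ Q)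
    (η : ℝ) (x₀ : EuclideanSpace ℝ (Fin 2)) :
    Var[fun ω => ∑ i, ![1, -1] i * sgdIterate curvature η x₀ ξ 2 ω i; Q] = η ^ 4 := by
  obtain ⟨e, he⟩ := noise_sub_ae_const hξ 0
  obtain ⟨e', he'⟩ := noise_sub_ae_const hξ 1
  -- Obtained by replacing `ξ 0 ω 1` with `ξ 0 ω 0 - e` and the difference of the coordinates of `ξ
  -- 1 ω` with `e'`.
  rw [variance_congr (Y := fun ω => (-η ^ 2) * ξ 0 ω 0
    + ((1 - η) ^ 2 * x₀ 0 - (1 - 2 * η) ^ 2 * x₀ 1 - (1 - 2 * η) * η * e - η * e'))]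
  · rw [variance_add_const ((hξ.memLp_two 0 0).const_mul _).aestronglyMeasurable,
      variance_const_mul, ← covariance_self (hξ.memLp_two 0 0).aemeasurable,
      hξ.covariance_eval noiseCov_posSemidef]
    simp [noiseCov]
    ring
  · filter_upwards [he, he'] with ω h h'
    simp only [Fin.sum_univ_two, sgdIterate_succ_apply curvature_isSymm, sgdIterate_zero]
    simp [curvature]
    linear_combination -η * h' - (1 - 2 * η) * η * h

end SGDComplexOU

/-! ### The contradiction at times `0`, `η` and `2η` -/

theorem mainTheorem6 :
    ∃ (d : ℕ) (A S : Matrix (Fin d) (Fin d) ℝ),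
      A.IsSymm ∧ S.PosSemidef ∧
      A.rank = d ∧ S.rank < d ∧
      (∀ (w : Fin d → ℝ) (a b : ℝ), w ≠ 0 → ¬ (A *ᵥ w = a • w ∧ S *ᵥ w = b • w)) ∧
      ∀ (η : ℝ), 0 < η →
      ∀ (x₀ : EuclideanSpace ℝ (Fin d))
        (Ω' : Type*) [MeasurableSpace Ω'] (Q : Measure Ω') [IsProbabilityMeasure Q]
        (ξ : ℕ → Ω' → EuclideanSpace ℝ (Fin d)),
        SGDComplexOU.IsGaussianNoise S ξ Q →
        ¬ ∃ (m : ℕ) (B : Matrix (Fin d) (Fin d) ℂ) (D : Matrix (Fin d) (Fin m) ℂ)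
            (Ω : Type*) (_ : MeasurableSpace Ω) (P : Measure Ω) (_ : IsProbabilityMeasure P)
            (W : ℝ≥0 → Ω → Fin m → ℝ) (X : ℝ≥0 → Ω → Fin d → ℂ),
            SGDComplexOU.IsComplexOU B D W X P ∧
            SGDComplexOU.MatchesIterates η X P (SGDComplexOU.sgdIterate A η x₀ ξ) Q := by
  open SGDComplexOU in
  refine ⟨2, curvature, noiseCov, curvature_isSymm, noiseCov_posSemidef, rank_curvature,
    rank_noiseCov_lt, no_common_eigenvector, ?_⟩
  rintro η hη x₀ Ω' _ Q _ ξ hξ ⟨m, B, D, Ω, _, P, _, W, X, hX, hM⟩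
  have hL := memLp_two_sgdIterate curvature_isSymm η x₀ hξ
  -- Matching at `k = 0` against a deterministic start kills the variance of every coordinate, so
  -- the initial value is almost surely constant.
  have hinit : ∀ i, ∃ c, ∀ᵐ ω ∂P, X 0 ω i = c := fun i => by
    have h := (hM 0).ae_const_iff (hL 0) (Pi.single i 1)
    have hv : Var[fun ω => ∑ j, Pi.single (M := fun _ => ℝ) i 1 j
        * sgdIterate curvature η x₀ ξ 0 ω j; Q] = 0 := by
      simp only [sgdIterate_zero]
      rw [← covariance_self aemeasurable_const, covariance_const_left]
    obtain ⟨c, hc⟩ := h.2 hv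
    refine ⟨c, hc.mono fun ω hω => ?_⟩
    rw [← hω]
    simp [-Fin.sum_univ_two, dotProduct, Pi.single_apply, apply_ite Complex.ofReal]
  choose c₀ hc₀ using hinit
  have h0 : ∀ᵐ ω ∂P, X 0 ω = c₀ := (ae_all_iff.2 hc₀).mono fun ω h => funext h
  obtain ⟨c, hc⟩ := ((hM 1).ae_const_iff (hL 1) _).2 (variance_coord_sub_sgdIterate_one hξ η x₀)
  have hpos : 0 < Real.toNNReal ((1 : ℕ) * η) := by simpa using hη
  have h2 := ((hM 2).ae_const_iff (hL 2) _).1 (hX.ae_const_of_ae_const h0 hpos hc _)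
  rw [variance_coord_sub_sgdIterate_two hξ] at h2
  exact hη.ne' (pow_eq_zero_iff four_ne_zero |>.1 h2)
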